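/- Let $\mathbb{K}$ be a commutative ring with unit. Associative $\mathbb{K}$-algebras are not required to have a unit. A (right) Leibniz algebra is a $\mathbb{K}$-module with a $\mathbb{K}$-bilinear bracket satisfying $[a,[b,c]]=[[a,b],c]-[[a,c],b]$. An $\mathrm{NP}^l$-algebra (noncommutative Leibniz–Poisson algebra) is an associative $\mathbb{K}$-algebra $P$ with a Leibniz bracket satisfying $[a\cdot b,c]=a\cdot[b,c]+[a,c]\cdot b$ for all $a,b,c\in P$; morphisms are $\mathbb{K}$-linear maps preserving dot and bracket. In each of these categories, an algebra is free on a family (or subset) of elements if every map from it to an algebra of the category extends uniquely to a morphism, and it is free if it is free on some subset. **Proposition.** If $P$ is a free $\mathrm{NP}^l$-algebra, then the underlying associative algebra of $P$ is a free associative algebra and the underlying Leibniz algebra of $P$ is a free Leibniz algebra. More explicitly, let $P$ be free on $X$, and identify the elements of $X$ with their images in $P$. Let $\mathcal{L},\mathcal{Y}\subseteq P$ be the smallest subsets such that $X\subseteq\mathcal{L}$, $X\subseteq\mathcal{Y}$, and, whenever $u\in\mathcal{L}$ and $v\in\mathcal{Y}$, one has $[u,v]\in\mathcal{L}$ and $v\cdot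 u\in\mathcal{Y}$. (So $\mathcal{L}$ consists of the elements of $X$ and the bracket words containing no subword of the form $[a\cdot b,c]$, $[a,[b,c]]$ or $[a,[b,d]\cdot c]$, and $\mathcal{Y}$ consists of the words $a\cdot u_1\cdots u_k$ with $k\ge 0$, $a\in X$ and $u_1,\dots,u_k\in\mathcal{L}$.) Then the underlying Leibniz algebra of $P$ is free on $\mathcal{Y}$. -/

import Mathlib

/-!
Conventions: `K` is a commutative ring with unit. As usual for these varieties, associative
algebras over `K` need not have a unit: such an algebra is a `NonUnitalRing A` with a `K`-module
structure satisfying `IsScalarTower K A A` and `SMulCommClass K A A`, and its homomorphisms are the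
maps `A →ₙₐ[K] B`. A bracket is a `K`-bilinear map, i.e. a `K`-linear map out of the tensor square.
-/

universe t u v w

namespace NPl

section Leibniz

variable {K : Type w} [CommRing K] {L : Type u} [AddCommGroup L] [Module K L]

/-- `β` makes the `K`-module `L` a (right) Leibniz algebra:
`[a,[b,c]] = [[a,b],c] - [[a,c],b]`. -/
def IsLeibniz (β : L →ₗ[K] L →ₗ[K] L) : Prop :=
  ∀ a b c : L, β a (β b c) = β (β a b) c - β (β a c) b

/-- The Leibniz algebra `(L, β)` is free on the family `j : Y → L`: every map from `Y` to a
Leibniz algebra extends uniquely to a homomorphism of Leibniz algebras. -/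
def IsFreeLeibnizOn (β : L →ₗ[K] L →ₗ[K] L) {Y : Type v} (j : Y → L) : Prop :=
  IsLeibniz β ∧
    ∀ (B : Type t) [AddCommGroup B] [Module K B] (γ : B →ₗ[K] B →ₗ[K] B), IsLeibniz γ →
      ∀ f : Y → B, ∃! φ : L →ₗ[K] B,
        (∀ a b : L, φ (β a b) = γ (φ a) (φ b)) ∧ ∀ y : Y, φ (j y) = f y

/-- The Leibniz algebra `(L, β)` is free, i.e. free on some subset. -/
def IsFreeLeibniz (β : L →ₗ[K] L →ₗ[K] L) : Prop :=
  ∃ S : Set L, IsFreeLeibnizOn.{t} β (Subtype.val : S → L)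

end Leibniz

section Associative

variable (K : Type w) [CommRing K] (A : Type u) [NonUnitalRing A] [Module K A]

/-- The associative `K`-algebra `A` is free on the family `j : Y → A`: every map from `Y` to an
associative `K`-algebra extends uniquely to a homomorphism of associative `K`-algebras. -/
def IsFreeAssociativeOn {Y : Type v} (j : Y → A) : Prop :=
  ∀ (B : Type t) [NonUnitalRing B] [Module K B] [IsScalarTower K B B] [SMulCommClass K B B]
    (f : Y → B), ∃! φ : A →ₙₐ[K] B, ∀ y : Y, φ (j y) = f y

/-- The associative `K`-algebra `A` is free, i.e. free on some subset. -/
def IsFreeAssociative : Prop :=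
  ∃ S : Set A, IsFreeAssociativeOn.{t} K A (Subtype.val : S → A)

end Associative

section NP

variable {K : Type w} [CommRing K] {P : Type u} [NonUnitalRing P] [Module K P]

/-- `β` makes the associative algebra `P` a left noncommutative (Leibniz-)Poisson algebra:
it is a Leibniz bracket and satisfies `[a · b, c] = a · [b,c] + [a,c] · b`. -/
structure IsNPl (β : P →ₗ[K] P →ₗ[K] P) : Prop where
  leibniz : IsLeibniz β
  poisson : ∀ a b c : P, β (a * b) c = a * β b c + β a c * b

/-- The `NP^l`-algebra `(P, β)` is free on the family `i : X → P`: every map from `X` to an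
`NP^l`-algebra extends uniquely to a `K`-linear map preserving dot and bracket. -/
def IsFreeNPlOn (β : P →ₗ[K] P →ₗ[K] P) {X : Type v} (i : X → P) : Prop :=
  IsNPl β ∧
    ∀ (B : Type t) [NonUnitalRing B] [Module K B] [IsScalarTower K B B] [SMulCommClass K B B]
      (γ : B →ₗ[K] B →ₗ[K] B), IsNPl γ →
      ∀ f : X → B, ∃! φ : P →ₙₐ[K] B,
        (∀ a b : P, φ (β a b) = γ (φ a) (φ b)) ∧ ∀ x : X, φ (i x) = f x

/-- The two kinds of words used below. -/
inductive WordKind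
  | letter
  | generator

/-- Words in dot and bracket on the family `i`, evaluated in `P`. Simultaneously:
the *letters* are the left-normed brackets `[…[[x, v₁], v₂], …, vₖ]` (`k ≥ 0`) with `x` in the
family and all `vⱼ` generators; the *generators* are the products `x · u₁ · … · uₖ` (`k ≥ 0`)
with `x` in the family and all `uⱼ` letters. Thus the letters are the elements `x` and the bracket
words containing no subword `[a · b, c]`, `[a, [b, c]]`, `[a, [b, d] · c]`, and the generators are
the words without such subwords whose first dot-factor is some `x`. -/
inductive IsWord (β : P →ₗ[K] P →ₗ[K] P) {X : Type v} (i : X → P) : WordKind → P → Prop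
  | of (k : WordKind) (x : X) : IsWord β i k (i x)
  | bracket {a b : P} : IsWord β i .letter a → IsWord β i .generator b →
      IsWord β i .letter (β a b)
  | dot {a b : P} : IsWord β i .generator a → IsWord β i .letter b →
      IsWord β i .generator (a * b)

/-- The set of generators in the sense of `IsWord`. -/
def leibnizGenerators (β : P →ₗ[K] P →ₗ[K] P) {X : Type v} (i : X → P) : Set P :=
  {p | IsWord β i .generator p}

end NP

end NPl

/-!
A free `NP^l`-algebra on `X` is identified with an explicit model. Let `𝓛` and `𝓨` be the sets of
formal letters and generators; both are in bijection with the binary trees with leaves in `X`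
(`Tree`). The model is the free associative algebra `A` on `𝓛` (`FreeAssoc`), so that `𝓨` is the set
of words in `A` whose first letter lies in `X`. Each `t ∈ 𝓨` acts on `A` by the derivation
`bracketGen` that sends the letter `u` to the letter `[u, t]`.

The heart of the matter is that `A`, with these operators, is a free module on `𝓨` over the free
unital associative algebra on `𝓨`: for every `K`-module `M` with elements `m t` and endomorphisms
`E t` there is exactly one linear map `A → M` that sends the generator `t` to `m t` and intertwines
`bracketGen t` with `E t`. Uniqueness is `submodule_eq_top_of_generator`, existence is
`equivariantLift`; both come from the identity `[u, t] · a = [u · a, t] - u · [a, t]`, which lowers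
the complexity of the first letter of a word.

Taking `M = End A` and `E t = [bracketGen t, -]` extends the action of the generators to a map
`b ↦ [-, b]` on all of `A` (`rightBracket`). Its values are derivations, which gives the Poisson
identity, and it is compatible with commutators, which gives the Leibniz identity. Taking for `M` a
Leibniz algebra and for `E t` the bracket with the image of `t`, the same principle shows that `A`
is free on `𝓨` as a Leibniz algebra (`isFreeLeibnizOn_generator`). A homomorphism of associative
algebras out of `A` is determined by its values on letters, and choosing them as the evaluations of
the letters yields a map that preserves brackets; thus `A` is free on `X` as an `NP^l`-algebra
(`isFreeNPlOn_leaf`). Hence `A` is isomorphic to any free `NP^l`-algebra on `X`, and both kinds of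
freeness are carried over.
-/

noncomputable section

namespace NPl

/-! ### Semigroup algebras of free semigroups -/

section FreeAlgebra

variable (K : Type w) [CommRing K] (α : Type v)

/-- The free associative algebra without unit on the set of letters `α`, with `K`-basis the
nonempty words in `α`. -/
abbrev FreeAssoc : Type (max v w) := MonoidAlgebra K (FreeSemigroup α)

variable {α}

/-- A nonempty word as an element of the free associative algebra. -/
def monomial (s : FreeSemigroup α) : FreeAssoc K α := MonoidAlgebra.single s 1

/-- A letter as an element of the free associative algebra. -/
def letter (u : α) : FreeAssoc K α := monomial K (FreeSemigroup.of u)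

variable {K}

theorem monomial_mul (r s : FreeSemigroup α) :
    monomial K (r * s) = monomial K r * monomial K s := by
  simp [monomial, MonoidAlgebra.single_mul_single]

theorem monomial_cons (u v : α) (l : List α) :
    monomial K ⟨u, v :: l⟩ = letter K u * monomial K ⟨v, l⟩ :=
  monomial_mul (FreeSemigroup.of u) ⟨v, l⟩

section Lift

variable {M : Type u} [AddCommGroup M] [Module K M]

/-- The linear map with prescribed values on the words. -/
def wordLift (f : FreeSemigroup α → M) : FreeAssoc K α →ₗ[K] M :=
  Finsupp.linearCombination K f ∘ₗ (MonoidAlgebra.coeffLinearEquiv K).toLinearMap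

@[simp]
theorem wordLift_monomial (f : FreeSemigroup α → M) (s : FreeSemigroup α) :
    wordLift f (monomial K s) = f s := by
  simp [wordLift, monomial]

theorem hom_ext_monomial {φ ψ : FreeAssoc K α →ₗ[K] M}
    (h : ∀ s, φ (monomial K s) = ψ (monomial K s)) : φ = ψ := by
  refine MonoidAlgebra.lhom_ext' fun s => LinearMap.ext_ring (h s)

end Lift

/-- Induction on words: a submodule is everything once it contains the letters and is stable under
left multiplication by letters. -/
theorem submodule_eq_top_of_letter {S : Submodule K (FreeAssoc K α)}
    (h₁ : ∀ u, letter K u ∈ S) (h₂ : ∀ u, ∀ a ∈ S, letter K u * a ∈ S) : S = ⊤ := by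
  have hw : ∀ (l : List α) (u : α), monomial K ⟨u, l⟩ ∈ S := by
    intro l
    induction l with
    | nil => exact h₁
    | cons v l ih => intro u; rw [monomial_cons]; exact h₂ _ _ (ih v)
  have : S.mkQ = 0 := hom_ext_monomial fun s => by
    simpa using hw s.tail s.head
  rw [← S.ker_mkQ, this, LinearMap.ker_zero]

theorem eq_of_letter {M : Type u} [AddCommGroup M] [Module K M] {φ ψ : FreeAssoc K α →ₗ[K] M}
    (h₁ : ∀ u, φ (letter K u) = ψ (letter K u))
    (h₂ : ∀ u a, φ a = ψ a → φ (letter K u * a) = ψ (letter K u * a)) (a : FreeAssoc K α) :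
    φ a = ψ a := by
  have : LinearMap.eqLocus φ ψ = ⊤ := submodule_eq_top_of_letter h₁ h₂
  exact LinearMap.congr_fun (LinearMap.eqLocus_eq_top.mp this) a

section AssocLift

variable {B : Type u} [NonUnitalRing B] [Module K B]

theorem assocHom_ext {φ ψ : FreeAssoc K α →ₙₐ[K] B}
    (h : ∀ u, φ (letter K u) = ψ (letter K u)) : φ = ψ := by
  refine NonUnitalAlgHom.ext fun a => ?_
  refine eq_of_letter (φ := (φ : FreeAssoc K α →ₗ[K] B)) (ψ := (ψ : FreeAssoc K α →ₗ[K] B))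
    h (fun u a ha => ?_) a
  have ha' : φ a = ψ a := ha
  change φ (letter K u * a) = ψ (letter K u * a)
  rw [map_mul, map_mul, h, ha']

variable [IsScalarTower K B B] [SMulCommClass K B B]

/-- The algebra homomorphism with prescribed values on the letters. -/
def assocLift (f : α → B) : FreeAssoc K α →ₙₐ[K] B :=
  MonoidAlgebra.liftMagma K (FreeSemigroup.lift f)

@[simp]
theorem assocLift_letter (f : α → B) (u : α) : assocLift f (letter K u) = f u := by
  simp [assocLift, letter, monomial]

theorem isFreeAssociativeOn_letter : IsFreeAssociativeOn.{t} K (FreeAssoc K α) (letter K) := by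
  intro B _ _ _ _ f
  exact ⟨assocLift f, assocLift_letter f, fun φ hφ => assocHom_ext fun u => by
    rw [hφ, assocLift_letter]⟩

end AssocLift

/-- The value on a word of the derivation with values `δ` on the letters. -/
def derivWord (δ : α → FreeAssoc K α) : α → List α → FreeAssoc K α
  | u, [] => δ u
  | u, v :: l => δ u * monomial K ⟨v, l⟩ + letter K u * derivWord δ v l

/-- The derivation of the free associative algebra with prescribed values on the letters. -/
def deriv (δ : α → FreeAssoc K α) : FreeAssoc K α →ₗ[K] FreeAssoc K α :=
  wordLift fun s => derivWord δ s.head s.tail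

@[simp]
theorem deriv_letter (δ : α → FreeAssoc K α) (u : α) : deriv δ (letter K u) = δ u := by
  simp [deriv, letter, derivWord, FreeSemigroup.of]

theorem deriv_letter_mul (δ : α → FreeAssoc K α) (u : α) (a : FreeAssoc K α) :
    deriv δ (letter K u * a) = δ u * a + letter K u * deriv δ a := by
  have : deriv δ ∘ₗ LinearMap.mulLeft K (letter K u) =
      LinearMap.mulLeft K (δ u) + LinearMap.mulLeft K (letter K u) ∘ₗ deriv δ :=
    hom_ext_monomial fun s => by
      obtain ⟨v, l⟩ := s
      change deriv δ (letter K u * monomial K ⟨v, l⟩) =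
        δ u * monomial K ⟨v, l⟩ + letter K u * deriv δ (monomial K ⟨v, l⟩)
      rw [← monomial_cons]
      simp [deriv, derivWord]
  exact LinearMap.congr_fun this a

theorem deriv_mul (δ : α → FreeAssoc K α) (a b : FreeAssoc K α) :
    deriv δ (a * b) = a * deriv δ b + deriv δ a * b := by
  refine eq_of_letter (φ := deriv δ ∘ₗ LinearMap.mulRight K b)
    (ψ := LinearMap.mulRight K (deriv δ b) + LinearMap.mulRight K b ∘ₗ deriv δ)
    (fun u => ?_) (fun u a ha => ?_) a
  · simp [deriv_letter_mul, add_comm]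
  · simp only [LinearMap.comp_apply, LinearMap.add_apply, LinearMap.mulRight_apply] at ha ⊢
    rw [mul_assoc, deriv_letter_mul, ha, deriv_letter_mul]
    simp only [mul_add, add_mul, mul_assoc]
    abel

end FreeAlgebra

/-! ### Trees, letters and generators -/

section Tree

/-- Binary trees with leaves in `X`. Each tree encodes both a letter and a generator: a leaf is an
element of `X`, and `node s t` is the letter `[s, t]` with `s` a letter and `t` a generator, as well
as the generator `s · t` with `s` a generator and `t` a letter. -/
inductive Tree (X : Type v) : Type v
  | leaf (x : X) : Tree X
  | node (s t : Tree X) : Tree X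

variable {K : Type w} [CommRing K] {X : Type v}

variable (K) in
/-- The generator encoded by a tree, written as a word in the letters. -/
def generator : Tree X → FreeAssoc K (Tree X)
  | .leaf x => letter K (.leaf x)
  | .node s t => generator s * letter K t

variable (K) in
/-- Bracketing with the generator encoded by `t` on the right: the derivation that sends a letter
`u` to the letter `[u, t]`. -/
def bracketGen (t : Tree X) : FreeAssoc K (Tree X) →ₗ[K] FreeAssoc K (Tree X) :=
  deriv fun u => letter K (.node u t)

/-- The tree whose generator is that of `t` multiplied by the word `v l`. -/
def graft : Tree X → Tree X → List (Tree X) → Tree X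
  | t, v, [] => .node t v
  | t, v, v' :: l => graft (.node t v) v' l

theorem generator_graft (t v : Tree X) (l : List (Tree X)) :
    generator K (graft t v l) = generator K t * monomial K ⟨v, l⟩ := by
  induction l generalizing t v with
  | nil => rfl
  | cons v' l ih => rw [graft, ih, generator, monomial_cons, mul_assoc]

/-- Induction along the free action: a submodule is everything once it contains the generators and
is stable under bracketing with generators on the right. -/
theorem submodule_eq_top_of_generator {S : Submodule K (FreeAssoc K (Tree X))}
    (h₁ : ∀ t, generator K t ∈ S) (h₂ : ∀ t, ∀ a ∈ S, bracketGen K t a ∈ S) : S = ⊤ := by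
  have key : ∀ u : Tree X, letter K u ∈ S ∧ ∀ a, letter K u * a ∈ S := by
    intro u
    induction u with
    | leaf x =>
      refine ⟨h₁ (.leaf x), fun a => ?_⟩
      have : S.mkQ ∘ₗ LinearMap.mulLeft K (letter K (.leaf x)) = 0 :=
        hom_ext_monomial fun s => by
          simpa [generator_graft, generator] using h₁ (graft (.leaf x) s.head s.tail)
      simpa using LinearMap.congr_fun this a
    | node u t ihu _ =>
      refine ⟨?_, fun a => ?_⟩
      · simpa [bracketGen] using h₂ t _ ihu.1
      · -- `[u, t] · a = [u · a, t] - u · [a, t]`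
        have := S.sub_mem (h₂ t _ (ihu.2 a)) (ihu.2 (bracketGen K t a))
        simpa [bracketGen, deriv_letter_mul] using this
  exact submodule_eq_top_of_letter (fun u => (key u).1) fun u a _ => (key u).2 a

section Recursion

variable {M : Type u} [AddCommGroup M] [Module K M] (m : Tree X → M) (E : Tree X → M →ₗ[K] M)

/-- The values on `u` and on the multiples `u · a` of the linear map `equivariantLift m E`. The
recursion rewrites `[u, t] · a` as `[u · a, t] - u · [a, t]`. -/
def equivariantAux : Tree X → M × (FreeAssoc K (Tree X) →ₗ[K] M)
  | .leaf x => (m (.leaf x), wordLift fun s => m (graft (.leaf x) s.head s.tail))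
  | .node u t => (E t (equivariantAux u).1,
      E t ∘ₗ (equivariantAux u).2 - (equivariantAux u).2 ∘ₗ bracketGen K t)

/-- The value on a word of the linear map `equivariantLift m E`. -/
def equivariantWord : Tree X → List (Tree X) → M
  | u, [] => (equivariantAux m E u).1
  | u, v :: l => (equivariantAux m E u).2 (monomial K ⟨v, l⟩)

/-- The unique linear map that sends each generator `t` to `m t` and intertwines bracketing with
`t` and `E t`. -/
def equivariantLift : FreeAssoc K (Tree X) →ₗ[K] M :=
  wordLift fun s => equivariantWord m E s.head s.tail

theorem equivariantLift_letter (u : Tree X) :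
    equivariantLift m E (letter K u) = (equivariantAux m E u).1 := by
  simp [equivariantLift, letter, equivariantWord, FreeSemigroup.of]

theorem equivariantLift_letter_mul (u : Tree X) (a : FreeAssoc K (Tree X)) :
    equivariantLift m E (letter K u * a) = (equivariantAux m E u).2 a := by
  have : equivariantLift m E ∘ₗ LinearMap.mulLeft K (letter K u) = (equivariantAux m E u).2 :=
    hom_ext_monomial fun s => by
      obtain ⟨v, l⟩ := s
      change equivariantLift m E (letter K u * monomial K ⟨v, l⟩) = _
      rw [← monomial_cons]
      simp [equivariantLift, equivariantWord]
  exact LinearMap.congr_fun this a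

theorem equivariantLift_generator_mul (t v : Tree X) (l : List (Tree X)) :
    equivariantLift m E (generator K t * monomial K ⟨v, l⟩) = m (graft t v l) := by
  induction t generalizing v l with
  | leaf x => rw [generator, equivariantLift_letter_mul]; simp [equivariantAux]
  | node s t ihs _ => rw [generator, mul_assoc, ← monomial_cons, ihs, graft]

@[simp]
theorem equivariantLift_generator (t : Tree X) :
    equivariantLift m E (generator K t) = m t := by
  cases t with
  | leaf x => rw [generator, equivariantLift_letter, equivariantAux]
  | node s t => exact equivariantLift_generator_mul m E s t []

@[simp]
theorem equivariantLift_bracketGen (t : Tree X) (a : FreeAssoc K (Tree X)) :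
    equivariantLift m E (bracketGen K t a) = E t (equivariantLift m E a) := by
  refine eq_of_letter (φ := equivariantLift m E ∘ₗ bracketGen K t)
    (ψ := E t ∘ₗ equivariantLift m E) (fun u => ?_) (fun u a _ => ?_) a
  · simp [bracketGen, equivariantLift_letter, equivariantAux]
  · simp [bracketGen, deriv_letter_mul, equivariantLift_letter_mul, equivariantAux]

end Recursion

end Tree

/-! ### The free noncommutative Leibniz–Poisson algebra -/

section Model

variable {K : Type w} [CommRing K] {X : Type v}

variable (K X) in
/-- Right bracketing operators: `rightBracket K X b` is `a ↦ [a, b]`. It is determined by its values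
on generators and by `[a, [b, t]] = [[a, b], t] - [[a, t], b]` for generators `t`. -/
def rightBracket : FreeAssoc K (Tree X) →ₗ[K] Module.End K (FreeAssoc K (Tree X)) :=
  equivariantLift (bracketGen K) fun t =>
    LinearMap.mulLeft K (A := Module.End K (FreeAssoc K (Tree X))) (bracketGen K t) -
      LinearMap.mulRight K (A := Module.End K (FreeAssoc K (Tree X))) (bracketGen K t)

@[simp]
theorem rightBracket_generator (t : Tree X) :
    rightBracket K X (generator K t) = bracketGen K t := by
  simp [rightBracket]

theorem rightBracket_bracketGen (t : Tree X) (b : FreeAssoc K (Tree X)) :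
    rightBracket K X (bracketGen K t b) =
      bracketGen K t * rightBracket K X b - rightBracket K X b * bracketGen K t := by
  simp [rightBracket]

/-- Each right bracketing operator is a derivation, being a Lie polynomial in the derivations
`bracketGen K t`. -/
theorem rightBracket_mul (c a b : FreeAssoc K (Tree X)) :
    rightBracket K X c (a * b) = a * rightBracket K X c b + rightBracket K X c a * b := by
  let S : Submodule K (FreeAssoc K (Tree X)) :=
    { carrier := {c | ∀ a b, rightBracket K X c (a * b) =
        a * rightBracket K X c b + rightBracket K X c a * b}
      zero_mem' := by simp
      add_mem' := by
        intro c d hc hd a b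
        simp only [Set.mem_ofPred_eq, map_add, LinearMap.add_apply] at hc hd ⊢
        rw [hc, hd, mul_add, add_mul]
        abel
      smul_mem' := by
        intro k c hc a b
        simp only [Set.mem_ofPred_eq, map_smul, LinearMap.smul_apply] at hc ⊢
        rw [hc, smul_add, mul_smul_comm, smul_mul_assoc] }
  have hS : S = ⊤ := by
    refine submodule_eq_top_of_generator (fun t a b => ?_) (fun t c hc a b => ?_)
    · rw [rightBracket_generator]; exact deriv_mul _ a b
    · have hd : ∀ a b, bracketGen K t (a * b) = a * bracketGen K t b + bracketGen K t a * b :=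
        deriv_mul _
      have hc' : ∀ a b, rightBracket K X c (a * b) =
        a * rightBracket K X c b + rightBracket K X c a * b := hc
      simp only [rightBracket_bracketGen, LinearMap.sub_apply, Module.End.mul_apply, hc', hd,
        map_add, mul_sub, sub_mul]
      abel
  have : c ∈ S := hS ▸ Submodule.mem_top
  exact this a b

/-- The right bracketing operators commute according to the Leibniz identity: the operators `D` with
`rightBracket (D b) = D * rightBracket b - rightBracket b * D` for all `b` form a Lie algebra
containing all `bracketGen K t`. -/
theorem rightBracket_rightBracket (c b : FreeAssoc K (Tree X)) :
    rightBracket K X (rightBracket K X c b) =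
      rightBracket K X c * rightBracket K X b - rightBracket K X b * rightBracket K X c := by
  let S : Submodule K (FreeAssoc K (Tree X)) :=
    { carrier := {c | ∀ b, rightBracket K X (rightBracket K X c b) =
        rightBracket K X c * rightBracket K X b - rightBracket K X b * rightBracket K X c}
      zero_mem' := by simp
      add_mem' := by
        intro c d hc hd b
        simp only [Set.mem_ofPred_eq, map_add, LinearMap.add_apply] at hc hd ⊢
        rw [hc, hd, mul_add, add_mul]
        abel
      smul_mem' := by
        intro k c hc b
        simp only [Set.mem_ofPred_eq, map_smul, LinearMap.smul_apply] at hc ⊢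
        rw [hc, smul_sub, mul_smul_comm, smul_mul_assoc] }
  have hS : S = ⊤ := by
    refine submodule_eq_top_of_generator (fun t b => ?_) (fun t c hc b => ?_)
    · rw [rightBracket_generator]; exact rightBracket_bracketGen t b
    · have hc' : ∀ b, rightBracket K X (rightBracket K X c b) =
        rightBracket K X c * rightBracket K X b - rightBracket K X b * rightBracket K X c := hc
      simp only [rightBracket_bracketGen, LinearMap.sub_apply, Module.End.mul_apply, hc',
        map_sub, mul_sub, sub_mul, mul_assoc]
      abel
  have : c ∈ S := hS ▸ Submodule.mem_top
  exact this b

variable (K X) in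
/-- The bracket of the free noncommutative Leibniz–Poisson algebra on `X`. -/
def freeBracket : FreeAssoc K (Tree X) →ₗ[K] FreeAssoc K (Tree X) →ₗ[K] FreeAssoc K (Tree X) :=
  (rightBracket K X).flip

theorem freeBracket_apply (a b : FreeAssoc K (Tree X)) :
    freeBracket K X a b = rightBracket K X b a := rfl

theorem freeBracket_generator (a : FreeAssoc K (Tree X)) (t : Tree X) :
    freeBracket K X a (generator K t) = bracketGen K t a := by
  rw [freeBracket_apply, rightBracket_generator]

theorem freeBracket_letter_generator (s t : Tree X) :
    freeBracket K X (letter K s) (generator K t) = letter K (.node s t) := by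
  rw [freeBracket_generator, bracketGen, deriv_letter]

theorem isLeibniz_freeBracket : IsLeibniz (freeBracket K X) := by
  intro a b c
  simp [freeBracket_apply, rightBracket_rightBracket]

theorem isNPl_freeBracket : IsNPl (freeBracket K X) :=
  ⟨isLeibniz_freeBracket, fun a b c => rightBracket_mul c a b⟩

section LeibnizHom

variable {B : Type u} [AddCommGroup B] [Module K B] {γ : B →ₗ[K] B →ₗ[K] B}

/-- A linear map into a Leibniz algebra preserves all brackets as soon as it preserves the brackets
whose right entry is a generator. -/
theorem map_freeBracket (hγ : IsLeibniz γ) {φ : FreeAssoc K (Tree X) →ₗ[K] B}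
    (h : ∀ a t, φ (bracketGen K t a) = γ (φ a) (φ (generator K t)))
    (a b : FreeAssoc K (Tree X)) : φ (freeBracket K X a b) = γ (φ a) (φ b) := by
  let S : Submodule K (FreeAssoc K (Tree X)) :=
    LinearMap.eqLocus ((freeBracket K X).flip.compr₂ φ) ((γ.compl₁₂ φ φ).flip)
  have mem_S (b) : b ∈ S ↔ ∀ a, φ (freeBracket K X a b) = γ (φ a) (φ b) := LinearMap.ext_iff
  have hS : S = ⊤ := by
    refine submodule_eq_top_of_generator (fun t => ?_) (fun t b hb => ?_)
    · rw [mem_S]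
      intro a
      rw [freeBracket_generator, h]
    · rw [mem_S] at hb ⊢
      intro a
      rw [← freeBracket_generator, isLeibniz_freeBracket, map_sub, hb, freeBracket_generator,
        freeBracket_generator, freeBracket_generator, h, hb, h, h, hγ]
  exact (mem_S b).mp (hS ▸ Submodule.mem_top) a

variable (K X) in
/-- The model is the free Leibniz algebra on the generators. -/
theorem isFreeLeibnizOn_generator :
    IsFreeLeibnizOn.{t} (freeBracket K X) (generator K (X := X)) := by
  refine ⟨isLeibniz_freeBracket, fun B _ _ γ hγ f => ?_⟩
  refine ⟨equivariantLift f fun t => γ.flip (f t), ⟨?_, by simp⟩, ?_⟩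
  · exact map_freeBracket hγ fun a t => by simp
  · rintro φ ⟨hφ, hf⟩
    have : LinearMap.eqLocus φ (equivariantLift f fun t => γ.flip (f t)) = ⊤ := by
      refine submodule_eq_top_of_generator (fun t => ?_) (fun t a ha => ?_)
      · simp [hf]
      · simp only [LinearMap.mem_eqLocus] at ha ⊢
        rw [equivariantLift_bracketGen, ← ha, ← freeBracket_generator, hφ, hf,
          LinearMap.flip_apply]
    exact LinearMap.eqLocus_eq_top.mp this

end LeibnizHom

/-- Words depend only on the set of values of the family. -/
theorem IsWord.reindex {K : Type w} [CommRing K] {P : Type u} [NonUnitalRing P] [Module K P]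
    {β : P →ₗ[K] P →ₗ[K] P} {X : Type v} {X' : Type*} {i : X → P} {i' : X' → P}
    (h : ∀ x, ∃ x', i' x' = i x) {k : WordKind} {p : P} (hp : IsWord β i k p) :
    IsWord β i' k p := by
  induction hp with
  | of k x =>
    obtain ⟨x', hx'⟩ := h x
    exact hx' ▸ .of k x'
  | bracket _ _ iha ihb => exact .bracket iha ihb
  | dot _ _ iha ihb => exact .dot iha ihb

section NPlHom

variable {B : Type u} [NonUnitalRing B] [Module K B]

/-- The letter and the generator encoded by a tree, evaluated in an algebra with dot and bracket. -/
def evalTree (γ : B →ₗ[K] B →ₗ[K] B) (f : X → B) : Tree X → B × B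
  | .leaf x => (f x, f x)
  | .node s t => (γ (evalTree γ f s).1 (evalTree γ f t).2,
      (evalTree γ f s).2 * (evalTree γ f t).1)

theorem isWord_generator_iff (γ : B →ₗ[K] B →ₗ[K] B) (f : X → B) (b : B) :
    IsWord γ f .generator b ↔ ∃ t, (evalTree γ f t).2 = b := by
  have h₁ : ∀ k b, IsWord γ f k b → ∃ t, WordKind.casesOn (motive := fun _ => B) k
      (evalTree γ f t).1 (evalTree γ f t).2 = b := by
    intro k b hb
    induction hb with
    | of k x => exact ⟨.leaf x, by cases k <;> rfl⟩
    | bracket _ _ iha ihb =>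
      obtain ⟨s, rfl⟩ := iha
      obtain ⟨t, rfl⟩ := ihb
      exact ⟨.node s t, rfl⟩
    | dot _ _ iha ihb =>
      obtain ⟨s, rfl⟩ := iha
      obtain ⟨t, rfl⟩ := ihb
      exact ⟨.node s t, rfl⟩
  have h₂ : ∀ t, IsWord γ f .letter (evalTree γ f t).1 ∧
      IsWord γ f .generator (evalTree γ f t).2 := by
    intro t
    induction t with
    | leaf x => exact ⟨.of _ x, .of _ x⟩
    | node s t ihs iht => exact ⟨.bracket ihs.1 iht.2, .dot ihs.2 iht.1⟩
  exact ⟨h₁ .generator b, by rintro ⟨t, rfl⟩; exact (h₂ t).2⟩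

theorem map_letter_generator {γ : B →ₗ[K] B →ₗ[K] B} {f : X → B}
    {φ : FreeAssoc K (Tree X) →ₙₐ[K] B}
    (h : ∀ a b, φ (freeBracket K X a b) = γ (φ a) (φ b))
    (hf : ∀ x, φ (letter K (.leaf x)) = f x) (t : Tree X) :
    φ (letter K t) = (evalTree γ f t).1 ∧ φ (generator K t) = (evalTree γ f t).2 := by
  induction t with
  | leaf x => exact ⟨hf x, hf x⟩
  | node s t ihs iht =>
    refine ⟨?_, ?_⟩
    · rw [← freeBracket_letter_generator, h, ihs.1, iht.2, evalTree]
    · rw [generator, map_mul, ihs.2, iht.1, evalTree]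

variable (K X) in
/-- The model is the free `NP^l`-algebra on the leaves. -/
theorem isFreeNPlOn_leaf :
    IsFreeNPlOn.{t} (freeBracket K X) (fun x : X => letter K (.leaf x)) := by
  refine ⟨isNPl_freeBracket, fun B _ _ _ _ γ hγ f => ?_⟩
  set φ : FreeAssoc K (Tree X) →ₙₐ[K] B := assocLift fun t => (evalTree γ f t).1 with hφ
  have hlet (t) : φ (letter K t) = (evalTree γ f t).1 := assocLift_letter _ t
  have hgen (t) : φ (generator K t) = (evalTree γ f t).2 := by
    induction t with
    | leaf x => exact hlet _
    | node s t ihs _ => rw [generator, map_mul, ihs, hlet, evalTree]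
  -- Both sides are derivations along `φ` in the argument `a` and agree on letters.
  have hder (t) (a) : φ (bracketGen K t a) = γ (φ a) (φ (generator K t)) := by
    refine eq_of_letter (φ := (φ : FreeAssoc K (Tree X) →ₗ[K] B) ∘ₗ bracketGen K t)
      (ψ := γ.flip (φ (generator K t)) ∘ₗ (φ : FreeAssoc K (Tree X) →ₗ[K] B))
      (fun u => ?_) (fun u a ha => ?_) a
    · change φ (bracketGen K t (letter K u)) = γ (φ (letter K u)) (φ (generator K t))
      rw [bracketGen, deriv_letter, hlet, hlet, hgen, evalTree]
    · have ha' : φ (bracketGen K t a) = γ (φ a) (φ (generator K t)) := ha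
      change φ (bracketGen K t (letter K u * a)) = γ (φ (letter K u * a)) (φ (generator K t))
      rw [bracketGen, deriv_letter_mul, ← bracketGen, map_add, map_mul, map_mul, map_mul, ha',
        hγ.poisson, hlet, hlet, hgen, evalTree, add_comm]
  refine ⟨φ, ⟨?_, fun x => hlet _⟩, ?_⟩
  · exact map_freeBracket hγ.leibniz (φ := (φ : FreeAssoc K (Tree X) →ₗ[K] B))
      fun a t => hder t a
  · rintro ψ ⟨hψ, hf⟩
    exact assocHom_ext fun t => by rw [hlet, (map_letter_generator hψ hf t).1]

end NPlHom

end Model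

/-! ### Transport along isomorphisms -/

section Transport

variable {K : Type w} [CommRing K]

theorem IsFreeLeibnizOn.range_comp {L : Type u} [AddCommGroup L] [Module K L]
    {P : Type*} [AddCommGroup P] [Module K P]
    {β : L →ₗ[K] L →ₗ[K] L} {β' : P →ₗ[K] P →ₗ[K] P} {Y : Type v} {j : Y → L}
    (hj : IsFreeLeibnizOn.{t} β j) (e : L ≃ₗ[K] P)
    (he : ∀ a b, e (β a b) = β' (e a) (e b)) :
    IsFreeLeibnizOn.{t} β' (Subtype.val : Set.range (e ∘ j) → P) := by
  have he' (a b) : e.symm (β' a b) = β (e.symm a) (e.symm b) := by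
    rw [LinearEquiv.symm_apply_eq, he, e.apply_symm_apply, e.apply_symm_apply]
  refine ⟨fun a b c => e.symm.injective ?_, fun B _ _ γ hγ f => ?_⟩
  · simp only [map_sub, he']
    exact hj.1 _ _ _
  obtain ⟨φ, ⟨hφ, hφf⟩, huniq⟩ := hj.2 B γ hγ fun y => f ⟨e (j y), y, rfl⟩
  refine ⟨φ ∘ₗ e.symm.toLinearMap, ⟨fun a b => ?_, ?_⟩, ?_⟩
  · simp [he', hφ]
  · rintro ⟨_, y, rfl⟩
    simpa using hφf y
  · rintro ψ ⟨hψ, hψf⟩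
    rw [← huniq (ψ ∘ₗ e.toLinearMap) ⟨fun a b => ?_, fun y => hψf ⟨e (j y), y, rfl⟩⟩]
    · ext; simp
    · simp [he, hψ]

theorem IsFreeAssociativeOn.range_comp {A : Type u} [NonUnitalRing A] [Module K A]
    {P : Type*} [NonUnitalRing P] [Module K P] {Y : Type v} {j : Y → A}
    (hj : IsFreeAssociativeOn.{t} K A j) (e : A →ₙₐ[K] P) (e' : P →ₙₐ[K] A)
    (h₁ : ∀ a, e' (e a) = a) (h₂ : ∀ p, e (e' p) = p) :
    IsFreeAssociativeOn.{t} K P (Subtype.val : Set.range (e ∘ j) → P) := by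
  intro B _ _ _ _ f
  obtain ⟨φ, hφf, huniq⟩ := hj B fun y => f ⟨e (j y), y, rfl⟩
  refine ⟨φ.comp e', ?_, ?_⟩
  · rintro ⟨_, y, rfl⟩
    simpa [h₁] using hφf y
  · intro ψ hψf
    rw [← huniq (ψ.comp e) fun y => hψf ⟨e (j y), y, rfl⟩]
    ext p
    simp [h₂]

/-- The uniqueness part of freeness also holds for maps to `P` itself, although its universe need
not be the one over which freeness quantifies. -/
theorem IsFreeNPlOn.eq_id {P : Type u} [NonUnitalRing P]
    [Module K P] [IsScalarTower K P P] [SMulCommClass K P P]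
    {β : P →ₗ[K] P →ₗ[K] P} {X : Type v} {i : X → P}
    (hP : IsFreeNPlOn.{max u v w} β i) (φ : P →ₙₐ[K] P)
    (hφ : ∀ a b, φ (β a b) = β (φ a) (φ b)) (hi : ∀ x, φ (i x) = i x) (p : P) : φ p = p := by
  let U := ULift.{max v w} P
  let e : U ≃ₗ[K] P := ULift.moduleEquiv
  let γ : U →ₗ[K] U →ₗ[K] U :=
    (β.compl₁₂ e.toLinearMap e.toLinearMap).compr₂ e.symm.toLinearMap
  have hγ : IsNPl γ := ⟨fun a b c => congrArg ULift.up (hP.1.leibniz a.down b.down c.down),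
    fun a b c => congrArg ULift.up (hP.1.poisson a.down b.down c.down)⟩
  have : IsScalarTower K U U := ⟨fun k a b => congrArg ULift.up (smul_mul_assoc k a.down b.down)⟩
  have : SMulCommClass K U U :=
    ⟨fun k a b => congrArg ULift.up (mul_smul_comm k a.down b.down).symm⟩
  let up : P →ₙₐ[K] U :=
    { toFun := ULift.up
      map_smul' := fun _ _ => rfl
      map_zero' := rfl
      map_add' := fun _ _ => rfl
      map_mul' := fun _ _ => rfl }
  have h := (hP.2 U γ hγ (up ∘ i)).unique (y₁ := up.comp φ) (y₂ := up)
    ⟨fun a b => congrArg ULift.up (hφ a b), fun x => congrArg ULift.up (hi x)⟩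
    ⟨fun a b => rfl, fun x => rfl⟩
  exact congrArg ULift.down (DFunLike.congr_fun h p)

end Transport

end NPl

end

theorem mainTheorem5 {K : Type w} [CommRing K] {P : Type u} [NonUnitalRing P]
    [Module K P] [IsScalarTower K P P] [SMulCommClass K P P]
    (β : P →ₗ[K] P →ₗ[K] P) {X : Type v} (i : X → P)
    (hP : NPl.IsFreeNPlOn.{max u v w} β i) :
    NPl.IsFreeAssociative.{t} K P ∧ NPl.IsFreeLeibniz.{t} β ∧
      NPl.IsFreeLeibnizOn.{t} β (Subtype.val : NPl.leibnizGenerators β i → P) := by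
  -- Lifting `X` puts the model in the universe over which the freeness of `P` quantifies.
  let X' := ULift.{max u w} X
  let A := NPl.FreeAssoc K (NPl.Tree X')
  obtain ⟨φ, ⟨hφ, hφi⟩, -⟩ := hP.2 A (NPl.freeBracket K X') NPl.isNPl_freeBracket
    fun x => NPl.letter K (.leaf ⟨x⟩)
  obtain ⟨ψ, ⟨hψ, hψi⟩, -⟩ := (NPl.isFreeNPlOn_leaf K X').2 P β hP.1 fun x => i x.down
  have hφψ (a : A) : φ (ψ a) = a := by
    have := ((NPl.isFreeNPlOn_leaf K X').2 A (NPl.freeBracket K X') NPl.isNPl_freeBracket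
      fun x => NPl.letter K (.leaf x)).unique (y₁ := φ.comp ψ) (y₂ := NonUnitalAlgHom.id K A)
      ⟨fun a b => by simp [hψ, hφ], fun x => (congrArg φ (hψi x)).trans (hφi x.down)⟩
      ⟨fun a b => rfl, fun x => rfl⟩
    exact DFunLike.congr_fun this a
  have hψφ (p : P) : ψ (φ p) = p :=
    hP.eq_id (ψ.comp φ) (fun a b => by simp [hφ, hψ]) (fun x => by simp [hφi, hψi]) p
  let e : A ≃ₗ[K] P :=
    { (ψ : A →ₗ[K] P) with
      invFun := φ
      left_inv := hφψ
      right_inv := hψφ }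
  have hL := (NPl.isFreeLeibnizOn_generator.{t} K X').range_comp e hψ
  have hgen : Set.range (e ∘ NPl.generator K) = NPl.leibnizGenerators β i := by
    ext p
    have hX : NPl.IsWord β (fun x : X' => i x.down) .generator p ↔
        NPl.IsWord β i .generator p := by
      constructor <;> intro h
      · exact h.reindex fun x : X' => ⟨x.down, rfl⟩
      · exact h.reindex fun x : X => ⟨⟨x⟩, rfl⟩
    refine Iff.trans (exists_congr fun t => ?_)
      ((NPl.isWord_generator_iff β (fun x : X' => i x.down) p).symm.trans hX)
    rw [← (NPl.map_letter_generator hψ hψi t).2]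
    rfl
  rw [hgen] at hL
  exact ⟨⟨_, NPl.isFreeAssociativeOn_letter.range_comp ψ φ hφψ hψφ⟩, ⟨_, hL⟩, hL⟩
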